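/- A constrained switching system $S=S(\mathbf G,\mathbf\Sigma)$ on $\mathbb R^n$ ($n\ge 1$) consists of an automaton $\mathbf G(V,E)$, i.e. a finite, strongly connected, directed graph with at least one edge, whose edges $(v,w,\sigma)\in E$ (from node $v$ to node $w$) carry labels $\sigma$ from a finite set, and of a real $n\times n$ matrix $A_\sigma$ for each label $\sigma$. A sequence of labels is accepted by $\mathbf G$ if it is the sequence of labels along some path (sequence of consecutive edges) of $\mathbf G$. The constrained joint spectral radius of $S$ is $$\hat\rho(S)=\lim_{t\to\infty}\ \max\bigl\{\|A_{\sigma(t)}\cdots A_{\sigma(1)}\|^{1/t} : \sigma(1),\dots,\sigma(t)\ \text{is accepted by } \mathbf G\bigr\},$$ where $\|\cdot\|$ is the operator norm induced by the Euclidean norm. Let $\gamma_*(S)$ be the infimum of all $\gamma\ge 0$ for which there are positive definite matrices $Q_v\in\mathbb R^{n\times n}$, $v\in V$, such that $\gamma^2Q_v-A_\sigma^\top Q_wA_\sigma\succeq 0$ for every edge $(v,w,\sigma)\in E$. For an integer $T\ge 1$, the $T$-product lift $S^T$ is the constrained switching system (whose graph need not be strongly connected; $\hat\rho$ and $\gamma_*$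 are defined for it by the same formulas) with the same nodes $V$ and with one edge from $v$ to $w$ for each path of length $T$ in $\mathbf G$ from $v$ to $w$, labelled by the sequence $\sigma(1)\dots\sigma(T)$ of labels along the path, the matrix of this label being $A_{\sigma(T)}\cdots A_{\sigma(1)}$. **Theorem.** The limit defining $\hat\rho(S)$ exists. For every integer $T\ge 1$, the limit defining $\hat\rho(S^T)$ exists, $\hat\rho(S^T)=\hat\rho(S)^T$, and $$\hat\rho(S)\ \le\ \gamma_*(S^T)^{1/T}\ \le\ n^{1/(2T)}\,\hat\rho(S).$$ **Corollary.** For every $r>0$, with $T=\max\bigl\{1,\lceil \log n/(2\log(1+r))\rceil\bigr\}$ (that is, $T=\lceil \log n/(2\log(1+r))\rceil$ if $n\ge 2$, and $T=1$ if $n=1$), $$\hat\rho(S)\ \le\ \gamma_*(S^T)^{1/T}\ \le\ (1+r)\,\hat\rho(S).$$ -/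

import Mathlib

open Filter Topology

/-- A directed labelled graph on the nodes `V`: every edge `e : E` goes from `src e` to `tgt e` and
carries the label `label e`. Several edges may join the same two nodes. -/
structure Automaton (V E Λ : Type*) where
  src : E → V
  tgt : E → V
  label : E → Λ

namespace Automaton

variable {V E Λ : Type*}

/-- Every node can be reached from every node along the edges. -/
def StronglyConnected (G : Automaton V E Λ) : Prop :=
  ∀ v w : V, Relation.ReflTransGen (fun a b => ∃ e : E, G.src e = a ∧ G.tgt e = b) v w

/-- A path is a sequence of consecutive edges, listed in the order in which they are traversed. -/
def IsPath (G : Automaton V E Λ) (p : List E) : Prop :=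
  p.IsChain (fun e f => G.tgt e = G.src f)

/-- A sequence of labels is accepted if some path carries it. -/
def Accepts (G : Automaton V E Λ) (w : List Λ) : Prop :=
  ∃ p : List E, G.IsPath p ∧ p.map G.label = w

/-- The paths of length `T`. -/
def Path (G : Automaton V E Λ) (T : ℕ) : Type _ :=
  {p : List E // p.length = T ∧ G.IsPath p}

/-- The accepted label sequences of length `T`. -/
def Word (G : Automaton V E Λ) (T : ℕ) : Type _ :=
  {w : List Λ // w.length = T ∧ G.Accepts w}

namespace Path

variable {G : Automaton V E Λ} {T : ℕ}

theorem ne_nil (hT : 1 ≤ T) (p : G.Path T) : p.1 ≠ [] := by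
  intro h
  have h1 := p.2.1
  rw [h, List.length_nil] at h1
  omega

/-- The word of labels along a path. -/
def word (p : G.Path T) : G.Word T :=
  ⟨p.1.map G.label, by rw [List.length_map]; exact p.2.1, p.1, p.2.2, rfl⟩

end Path

end Automaton

/-- The constrained switching system on `ℝⁿ` with automaton `graph`, in which the mode (label) `σ`
acts by the matrix `mat σ`. -/
structure SwitchingSystem (V E Λ : Type*) (n : ℕ) where
  graph : Automaton V E Λ
  mat : Λ → Matrix (Fin n) (Fin n) ℝ

namespace SwitchingSystem

variable {V E Λ : Type*} {n : ℕ}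

/-- For `w = [σ(1), …, σ(T)]`, the product `A_{σ(T)} ⋯ A_{σ(1)}` (the identity if `T = 0`). -/
def wordProd (S : SwitchingSystem V E Λ n) (w : List Λ) : Matrix (Fin n) (Fin n) ℝ :=
  (w.map S.mat).reverse.prod

/-- The maximum of `‖A_{σ(t)} ⋯ A_{σ(1)}‖ ^ (1 / t)` over the accepted label sequences of length
`t`, where `‖·‖` is the operator norm induced by the Euclidean norm. -/
noncomputable def growth (S : SwitchingSystem V E Λ n) (t : ℕ) : ℝ :=
  sSup {x : ℝ | ∃ w : List Λ, w.length = t ∧ S.graph.Accepts w ∧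
    x = ‖Matrix.toEuclideanCLM (n := Fin n) (𝕜 := ℝ) (S.wordProd w)‖ ^ (1 / (t : ℝ))}

/-- The constrained joint spectral radius. -/
noncomputable def cjsr (S : SwitchingSystem V E Λ n) : ℝ :=
  limUnder atTop S.growth

/-- The optimal value over the quadratic multinorms: the infimum of the `γ ≥ 0` for which there are
positive definite matrices `Q v`, `v ∈ V`, such that `γ² Q v - Aᵀ (Q w) A` is positive semidefinite
for every edge from `v` to `w`, with `A` the matrix of its label. -/
noncomputable def gammaStar (S : SwitchingSystem V E Λ n) : ℝ :=
  sInf {γ : ℝ | 0 ≤ γ ∧ ∃ Q : V → Matrix (Fin n) (Fin n) ℝ, (∀ v, (Q v).PosDef) ∧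
    ∀ e : E, (γ ^ 2 • Q (S.graph.src e) - (S.mat (S.graph.label e)).transpose *
      Q (S.graph.tgt e) * S.mat (S.graph.label e)).PosSemidef}

/-- The `T`-product lift: same nodes, one edge per path of length `T` (from the first node of the
path to its last node), labelled by the word of labels along the path; an accepted word
`[σ(1), …, σ(T)]` acts by `A_{σ(T)} ⋯ A_{σ(1)}`. -/
def prodLift (S : SwitchingSystem V E Λ n) (T : ℕ) (hT : 1 ≤ T) :
    SwitchingSystem V (S.graph.Path T) (S.graph.Word T) n where
  graph :=
    { src := fun p => S.graph.src (p.1.head (p.ne_nil hT))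
      tgt := fun p => S.graph.tgt (p.1.getLast (p.ne_nil hT))
      label := fun p => p.word }
  mat := fun w => S.wordProd w.1

end SwitchingSystem

/-! Word norms are submultiplicative under concatenation, so Fekete's lemma gives the limit. Cutting
paths into blocks of length `T` identifies the growth of the lift at time `t` with the `T`-th power
of the growth of `S` at time `t * T`; hence `prodLift_cjsr`. It then suffices to prove `cjsr ≤
gammaStar ≤ √n * cjsr` for an arbitrary system, apply this to the lift and take `T`-th roots.

Lower bound (`IsFeasible.cjsr_le`): feasible `Q v` form a Lyapunov function that grows by at most `γ
^ 2` per edge, and comparing it with the Euclidean norm costs a constant that disappears in the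
limit.

Upper bound (`exists_isFeasible`): for `γ > cjsr`, let `|x|_v` be the supremum of `γ ^ (-|p|) * ‖A_p
x‖` over the paths `p` from `v`. This is a norm with `|A x|_w ≤ γ * |x|_v` along each edge from `v`
to `w`. By John's theorem (`exists_posDef_john`) some quadratic form satisfies `Q v ≤ |·|_v ^ 2 ≤ n
* Q v`, so the `Q v` are feasible for `√n * γ`. -/

/-! ### Existence of the limit -/

/-- Fekete's lemma for a sequence whose powers `g t ^ t` are submultiplicative. -/
theorem exists_tendsto_of_pow_submultiplicative {g : ℕ → ℝ} (hg : ∀ t, 0 ≤ g t)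
    (hmul : ∀ s t, 1 ≤ s → 1 ≤ t → g (s + t) ^ (s + t) ≤ g s ^ s * g t ^ t) :
    ∃ l, Tendsto g atTop (𝓝 l) := by
  -- Since `g` may vanish, logarithms are taken after truncating from below at `c > 0`, which
  -- preserves submultiplicativity of the powers.
  have key : ∀ c : ℝ, 0 < c → ∃ l, Tendsto (fun t => max (g t) c) atTop (𝓝 l) := by
    intro c hc
    have hpos : ∀ t, 0 < max (g t) c := fun t => lt_max_of_lt_right hc
    set u : ℕ → ℝ := fun t => t * Real.log (max (g t) c) with hu
    have hue : ∀ t, Real.exp (u t) = max (g t) c ^ t := fun t => by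
      simp only [hu]
      rw [← Real.log_pow, Real.exp_log (pow_pos (hpos t) t)]
    have hsub : Subadditive u := by
      intro s t
      rcases Nat.eq_zero_or_pos s with rfl | hs
      · simp [hu]
      rcases Nat.eq_zero_or_pos t with rfl | ht
      · simp [hu]
      rw [← Real.exp_le_exp, Real.exp_add, hue, hue, hue]
      rcases max_cases (g (s + t)) c with ⟨h, -⟩ | ⟨h, -⟩ <;> rw [h]
      · exact (hmul s t hs ht).trans (mul_le_mul
          (pow_le_pow_left₀ (hg s) (le_max_left _ _) s)
          (pow_le_pow_left₀ (hg t) (le_max_left _ _) t) (pow_nonneg (hg t) t)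
          (pow_nonneg (hpos s).le s))
      · rw [pow_add]
        exact mul_le_mul (pow_le_pow_left₀ hc.le (le_max_right _ _) s)
          (pow_le_pow_left₀ hc.le (le_max_right _ _) t) (pow_nonneg hc.le t)
          (pow_nonneg (hpos s).le s)
    have hdiv : ∀ t : ℕ, t ≠ 0 → u t / t = Real.log (max (g t) c) := fun t ht =>
      mul_div_cancel_left₀ _ (Nat.cast_ne_zero.2 ht)
    have hbdd : BddBelow (Set.range fun t => u t / t) := by
      -- The `0` accounts for `t = 0`, where the quotient is `0 / 0 = 0`.
      refine ⟨min 0 (Real.log c), ?_⟩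
      rintro _ ⟨t, rfl⟩
      rcases Nat.eq_zero_or_pos t with rfl | ht
      · simp
      · simp only [hdiv t ht.ne']
        exact (min_le_right _ _).trans (Real.log_le_log hc (le_max_right _ _))
    refine ⟨Real.exp hsub.lim, ?_⟩
    refine ((Real.continuous_exp.tendsto _).comp (hsub.tendsto_lim hbdd)).congr' ?_
    filter_upwards [eventually_ne_atTop 0] with t ht
    rw [Function.comp_apply, hdiv t ht, Real.exp_log (hpos t)]
  -- If some truncated limit exceeds its `c`, the truncation is eventually inactive; otherwise every
  -- truncated limit is at most `c`, which forces `g → 0`.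
  by_cases h : ∃ c : ℝ, 0 < c ∧ ∃ l, c < l ∧ Tendsto (fun t => max (g t) c) atTop (𝓝 l)
  · obtain ⟨c, -, l, hcl, hl⟩ := h
    refine ⟨l, hl.congr' ?_⟩
    filter_upwards [hl.eventually_const_lt hcl] with t ht
    exact max_eq_left ((lt_max_iff.1 ht).resolve_right (lt_irrefl c)).le
  · push Not at h
    refine ⟨0, tendsto_order.2 ⟨fun a ha => Eventually.of_forall fun t => ha.trans_le (hg t),
      fun a ha => ?_⟩⟩
    obtain ⟨l, hl⟩ := key (a / 2) (half_pos ha)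
    have hla : l < a := lt_of_not_ge fun hal =>
      h (a / 2) (half_pos ha) l ((half_lt_self ha).trans_le hal) hl
    filter_upwards [hl.eventually_lt_const hla] with t ht
    exact (le_max_left _ _).trans_lt ht

namespace SwitchingSystem

variable {V E Λ : Type*} {n : ℕ} (S : SwitchingSystem V E Λ n)

local notation "‖" M "‖₂" => ‖Matrix.toEuclideanCLM (n := Fin _) (𝕜 := ℝ) M‖

theorem wordProd_append (v w : List Λ) : S.wordProd (v ++ w) = S.wordProd w * S.wordProd v := by
  simp [wordProd]

theorem wordProd_cons (σ : Λ) (w : List Λ) : S.wordProd (σ :: w) = S.wordProd w * S.mat σ := by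
  simp [wordProd]

theorem growth_nonneg (t : ℕ) : 0 ≤ S.growth t :=
  Real.sSup_nonneg (by rintro _ ⟨w, -, -, rfl⟩; positivity)

/-- If no word of length `t` is accepted, the supremum is `0` by convention, which `0 ≤ b` covers.
-/
theorem growth_le {t : ℕ} (ht : 1 ≤ t) {b : ℝ} (hb : 0 ≤ b)
    (h : ∀ w : List Λ, w.length = t → S.graph.Accepts w → ‖S.wordProd w‖₂ ≤ b ^ t) :
    S.growth t ≤ b := by
  refine Real.sSup_le ?_ hb
  rintro _ ⟨w, hw, hw', rfl⟩
  rw [one_div]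
  exact (Real.rpow_le_rpow (norm_nonneg _) (h w hw hw') (by positivity)).trans_eq
    (Real.pow_rpow_inv_natCast hb (by omega))

theorem norm_wordProd_le_growth_pow [Finite E] {t : ℕ} (ht : 1 ≤ t) {w : List Λ}
    (hw : w.length = t) (hacc : S.graph.Accepts w) : ‖S.wordProd w‖₂ ≤ S.growth t ^ t := by
  have hfin : {w : List Λ | w.length = t ∧ S.graph.Accepts w}.Finite := by
    refine ((List.finite_length_eq E t).image (List.map S.graph.label)).subset ?_
    rintro _ ⟨h, p, -, rfl⟩
    exact ⟨p, by simpa using h, rfl⟩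
  have hle : ‖S.wordProd w‖₂ ^ (1 / (t : ℝ)) ≤ S.growth t := by
    refine le_csSup ((hfin.image fun w => ‖S.wordProd w‖₂ ^ (1 / (t : ℝ))).subset ?_).bddAbove
      ⟨w, hw, hacc, rfl⟩
    rintro _ ⟨v, hv, hv', rfl⟩
    exact ⟨v, ⟨hv, hv'⟩, rfl⟩
  rw [one_div] at hle
  calc ‖S.wordProd w‖₂ = (‖S.wordProd w‖₂ ^ ((t : ℝ)⁻¹)) ^ t :=
        (Real.rpow_inv_natCast_pow (norm_nonneg _) (by omega)).symm
    _ ≤ S.growth t ^ t := pow_le_pow_left₀ (by positivity) hle t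

theorem _root_.Automaton.Accepts.of_append {G : Automaton V E Λ} {v w : List Λ}
    (h : G.Accepts (v ++ w)) : G.Accepts v ∧ G.Accepts w := by
  obtain ⟨p, hp, hpw⟩ := h
  obtain ⟨q, r, rfl, rfl, rfl⟩ := List.map_eq_append_iff.1 hpw
  have := List.isChain_append.1 hp
  exact ⟨⟨q, this.1, rfl⟩, ⟨r, this.2.1, rfl⟩⟩

theorem growth_pow_submultiplicative [Finite E] {s t : ℕ} (hs : 1 ≤ s) (ht : 1 ≤ t) :
    S.growth (s + t) ^ (s + t) ≤ S.growth s ^ s * S.growth t ^ t := by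
  have h0 : 0 ≤ S.growth s ^ s * S.growth t ^ t :=
    mul_nonneg (pow_nonneg (S.growth_nonneg s) s) (pow_nonneg (S.growth_nonneg t) t)
  have hne : s + t ≠ 0 := by omega
  rw [← Real.rpow_inv_natCast_pow h0 hne]
  refine pow_le_pow_left₀ (S.growth_nonneg _) (S.growth_le (by omega) (by positivity) ?_) _
  intro w hw hacc
  rw [Real.rpow_inv_natCast_pow h0 hne]
  rw [← List.take_append_drop s w] at hacc ⊢
  obtain ⟨h1, h2⟩ := hacc.of_append
  rw [wordProd_append, map_mul, mul_comm (S.growth s ^ s)]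
  refine (norm_mul_le _ _).trans (mul_le_mul
    (S.norm_wordProd_le_growth_pow ht (by simp [hw]) h2)
    (S.norm_wordProd_le_growth_pow hs (by simp [hw]) h1) (norm_nonneg _)
    (pow_nonneg (S.growth_nonneg t) t))

theorem tendsto_growth [Finite E] : Tendsto S.growth atTop (𝓝 S.cjsr) := by
  obtain ⟨l, hl⟩ := exists_tendsto_of_pow_submultiplicative S.growth_nonneg
    fun s t hs ht => S.growth_pow_submultiplicative hs ht
  rwa [cjsr, hl.limUnder_eq]

theorem cjsr_nonneg [Finite E] : 0 ≤ S.cjsr :=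
  ge_of_tendsto' S.tendsto_growth S.growth_nonneg

end SwitchingSystem

namespace Automaton

variable {V E Λ : Type*} {G : Automaton V E Λ} {T : ℕ}

/-- The edges of a path of length `T`. -/
def Path.edges (p : G.Path T) : List E := p.1

/-- The labels of an accepted word of length `T`. -/
def Word.labels (w : G.Word T) : List Λ := w.1

theorem Path.length_edges (p : G.Path T) : p.edges.length = T := p.2.1

theorem Path.isPath_edges (p : G.Path T) : G.IsPath p.edges := p.2.2

end Automaton

/-! ### The product lift -/

namespace SwitchingSystem

variable {V E Λ : Type*} {n : ℕ} (S : SwitchingSystem V E Λ n)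

section Lift

variable {T : ℕ} (hT : 1 ≤ T)

theorem prodLift_wordProd (w : List (S.graph.Word T)) :
    (S.prodLift T hT).wordProd w = S.wordProd (w.map Automaton.Word.labels).flatten := by
  induction w with
  | nil => rfl
  | cons σ w ih => rw [wordProd_cons, ih, List.map_cons, List.flatten_cons, wordProd_append]; rfl

/-- Consecutiveness inside each block is automatic, so only the junctions between blocks matter, and
these are the adjacencies of the lift. -/
theorem prodLift_isPath_iff (q : List (S.graph.Path T)) :
    (S.prodLift T hT).graph.IsPath q ↔ S.graph.IsPath (q.map Automaton.Path.edges).flatten := by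
  have hnil : [] ∉ q.map Automaton.Path.edges := by
    rintro h
    obtain ⟨p, -, hp⟩ := List.mem_map.1 h
    exact p.ne_nil hT hp
  unfold Automaton.IsPath
  rw [List.isChain_flatten hnil, List.isChain_map]
  have hall : ∀ l ∈ q.map Automaton.Path.edges, l.IsChain (fun e f => S.graph.tgt e = S.graph.src f) := by
    intro l hl
    obtain ⟨p, -, rfl⟩ := List.mem_map.1 hl
    exact p.isPath_edges
  have hrel : (fun a b : S.graph.Path T =>
      ∀ x ∈ a.edges.getLast?, ∀ y ∈ b.edges.head?, S.graph.tgt x = S.graph.src y) =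
      fun a b => (S.prodLift T hT).graph.tgt a = (S.prodLift T hT).graph.src b := by
    funext a b
    simp only [Automaton.Path.edges]
    rw [List.getLast?_eq_some_getLast (a.ne_nil hT), List.head?_eq_some_head (b.ne_nil hT)]
    simp [prodLift]
  rw [hrel]
  exact (and_iff_right hall).symm

theorem length_flatten_of_forall_length {α : Type*} {l : List (List α)}
    (h : ∀ a ∈ l, a.length = T) : l.flatten.length = l.length * T := by
  induction l with
  | nil => simp
  | cons a l ih =>
    rw [List.flatten_cons, List.length_append, ih fun b hb => h b (List.mem_cons_of_mem a hb),
      h a List.mem_cons_self, List.length_cons]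
    ring

theorem _root_.Automaton.IsPath.exists_flatten {G : Automaton V E Λ} :
    ∀ (t : ℕ) (p : List E), p.length = t * T → G.IsPath p →
      ∃ q : List (G.Path T), q.length = t ∧ (q.map Automaton.Path.edges).flatten = p
  | 0, p, hp, _ => ⟨[], rfl, by simp at hp; simp [hp]⟩
  | t + 1, p, hp, hpath => by
    have hpT : p.length = t * T + T := by rw [hp]; ring
    unfold Automaton.IsPath at hpath
    rw [← List.take_append_drop T p, List.isChain_append] at hpath
    obtain ⟨q, hq, hqp⟩ := Automaton.IsPath.exists_flatten t (p.drop T)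
      (by rw [List.length_drop, hpT]; omega) hpath.2.1
    have hlen : (p.take T).length = T := by rw [List.length_take, hpT]; omega
    let a : G.Path T := ⟨p.take T, hlen, hpath.1⟩
    refine ⟨a :: q, congrArg (· + 1) hq, ?_⟩
    rw [List.map_cons, List.flatten_cons, hqp]
    exact List.take_append_drop T p

theorem map_label_flatten (q : List (S.graph.Path T)) :
    ((q.map (S.prodLift T hT).graph.label).map Automaton.Word.labels).flatten =
      (q.map Automaton.Path.edges).flatten.map S.graph.label := by
  rw [List.map_flatten, List.map_map, List.map_map]
  rfl

instance [Finite E] : Finite (S.graph.Path T) :=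
  ((List.finite_length_eq E T).subset fun _ hp => hp.1).to_subtype

theorem prodLift_growth [Finite E] {t : ℕ} (ht : 1 ≤ t) :
    (S.prodLift T hT).growth t = S.growth (t * T) ^ T := by
  have htT : 1 ≤ t * T := Nat.mul_pos ht hT
  apply le_antisymm
  · refine growth_le _ ht (pow_nonneg (S.growth_nonneg _) _) ?_
    rintro _ hw ⟨q, hq, rfl⟩
    rw [List.length_map] at hw
    rw [prodLift_wordProd, map_label_flatten, ← pow_mul, mul_comm T t]
    refine S.norm_wordProd_le_growth_pow htT ?_ ⟨_, (S.prodLift_isPath_iff hT q).1 hq, rfl⟩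
    rw [List.length_map, length_flatten_of_forall_length (T := T), List.length_map, hw]
    intro l hl
    obtain ⟨p, -, rfl⟩ := List.mem_map.1 hl
    exact p.length_edges
  · have h0 := (S.prodLift T hT).growth_nonneg t
    have hroot := Real.rpow_inv_natCast_pow h0 (show T ≠ 0 by omega)
    rw [← hroot]
    refine pow_le_pow_left₀ (S.growth_nonneg _)
      (S.growth_le htT (by positivity) ?_) T
    rintro _ hw ⟨p, hp, rfl⟩
    rw [List.length_map] at hw
    obtain ⟨q, hq, rfl⟩ := Automaton.IsPath.exists_flatten t p hw hp
    rw [mul_comm t T, pow_mul, hroot, ← S.map_label_flatten hT, ← S.prodLift_wordProd hT]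
    exact norm_wordProd_le_growth_pow _ ht (by simp [hq])
      ⟨q, (S.prodLift_isPath_iff hT q).2 hp, rfl⟩

theorem prodLift_cjsr [Finite E] : (S.prodLift T hT).cjsr = S.cjsr ^ T := by
  refine tendsto_nhds_unique (S.prodLift T hT).tendsto_growth ?_
  refine ((S.tendsto_growth.comp
    (tendsto_id.atTop_mul_const' (show 0 < T by omega))).pow T).congr' ?_
  filter_upwards [eventually_ge_atTop 1] with t ht
  exact (S.prodLift_growth hT ht).symm

end Lift

end SwitchingSystem

/-! ### John's theorem by determinant maximization -/

namespace Matrix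

variable {n : ℕ}

theorem PosSemidef.abs_apply_le {Q : Matrix (Fin n) (Fin n) ℝ} (hQ : Q.PosSemidef)
    (i j : Fin n) : |Q i j| ≤ Q i i + Q j j := by
  have hsymm : Q j i = Q i j := by simpa using hQ.1.apply i j
  have h1 := hQ.dotProduct_mulVec_nonneg (Pi.single i 1 + Pi.single j 1)
  have h2 := hQ.dotProduct_mulVec_nonneg (Pi.single i 1 - Pi.single j 1)
  have hi := hQ.diag_nonneg (i := i)
  have hj := hQ.diag_nonneg (i := j)
  simp [mulVec_add, mulVec_sub, add_dotProduct, sub_dotProduct] at h1 h2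
  rw [abs_le]
  constructor <;> linarith

/-- This is the matrix determinant lemma for a rank-one update. The derivative of the last factor at
`t = 0` is `y ⬝ᵥ Q⁻¹ *ᵥ y - (m + 1)`, the quantity that a maximal determinant controls. -/
theorem det_convexCombination_vecMulVec {m : ℕ} {Q : Matrix (Fin (m + 1)) (Fin (m + 1)) ℝ}
    (hQ : IsUnit Q.det) (y : Fin (m + 1) → ℝ) {t : ℝ} (ht : t < 1) :
    ((1 - t) • Q + t • vecMulVec y y).det =
      Q.det * ((1 - t) ^ m * (1 + t * (y ⬝ᵥ Q⁻¹ *ᵥ y - 1))) := by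
  have ht' : (1 - t) ≠ 0 := by linarith
  have hsplit : (1 - t) • Q + t • vecMulVec y y =
      (1 - t) • (Q + replicateCol Unit ((t / (1 - t)) • y) * replicateRow Unit y) := by
    rw [← vecMulVec_eq, smul_add, smul_vecMulVec, smul_smul, mul_div_cancel₀ _ ht']
  rw [hsplit, det_smul, det_add_replicateCol_mul_replicateRow hQ, Fintype.card_fin,
    det_unique (n := Unit)]
  have hentry : (replicateRow Unit y * Q⁻¹ * replicateCol Unit ((t / (1 - t)) • y))
      default default = t / (1 - t) * (y ⬝ᵥ Q⁻¹ *ᵥ y) := by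
    rw [Matrix.mul_assoc, ← replicateCol_mulVec, mulVec_smul]
    simp [mul_apply, dotProduct, Finset.mul_sum, mul_left_comm]
  rw [add_apply, one_apply_eq, hentry]
  field_simp
  ring

/-- Cauchy–Schwarz for the inner product of `Q`, applied to `x` and `Q⁻¹ *ᵥ y`. -/
theorem PosDef.sq_dotProduct_le {Q : Matrix (Fin n) (Fin n) ℝ} (hQ : Q.PosDef)
    {y : Fin n → ℝ} {c : ℝ} (hc : 0 < c) (hy : y ⬝ᵥ Q⁻¹ *ᵥ y ≤ c) (x : Fin n → ℝ) :
    (y ⬝ᵥ x) ^ 2 ≤ c * (x ⬝ᵥ Q *ᵥ x) := by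
  have hdet : IsUnit Q.det := (isUnit_iff_isUnit_det _).1 hQ.isUnit
  have hQt : Qᵀ = Q := by simpa using hQ.1.eq
  set z := Q⁻¹ *ᵥ y with hz
  have hQz : Q *ᵥ z = y := by rw [hz, mulVec_mulVec, mul_nonsing_inv _ hdet, one_mulVec]
  have hzx : z ⬝ᵥ Q *ᵥ x = y ⬝ᵥ x := by
    rw [dotProduct_mulVec, ← mulVec_transpose, hQt, hQz]
  set l := (y ⬝ᵥ x) / c with hl
  have h := hQ.posSemidef.dotProduct_mulVec_nonneg (x - l • z)
  have hlc : l * c = y ⬝ᵥ x := div_mul_cancel₀ _ hc.ne'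
  simp only [star_trivial, mulVec_sub, mulVec_smul, sub_dotProduct, dotProduct_sub,
    smul_dotProduct, dotProduct_smul, smul_eq_mul, hQz, hzx, dotProduct_comm x y,
    dotProduct_comm z y] at h
  nlinarith [mul_nonneg (sq_nonneg l) (sub_nonneg.2 hy), mul_nonneg hc.le h]

/-- **John's theorem** for a symmetric set of linear functionals `y ⬝ᵥ ·`, `y ∈ Y`. -/
theorem exists_posDef_john (hn : 1 ≤ n) {Y : Set (Fin n → ℝ)} {K : ℝ}
    (hY : ∀ y ∈ Y, ∀ i, |y i| ≤ K)
    (hball : ∀ (x : Fin n → ℝ) (c : ℝ), (∀ y ∈ Y, (y ⬝ᵥ x) ^ 2 ≤ c) → x ⬝ᵥ x ≤ c) :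
    ∃ Q : Matrix (Fin n) (Fin n) ℝ, Q.PosDef ∧
      (∀ y ∈ Y, ∀ x, (y ⬝ᵥ x) ^ 2 ≤ n * (x ⬝ᵥ Q *ᵥ x)) ∧
      ∀ (x : Fin n → ℝ) (c : ℝ), (∀ y ∈ Y, (y ⬝ᵥ x) ^ 2 ≤ c) → x ⬝ᵥ Q *ᵥ x ≤ c := by
  set F : Set (Matrix (Fin n) (Fin n) ℝ) := {Q | Q.PosSemidef ∧
    ∀ (x : Fin n → ℝ) (c : ℝ), (∀ y ∈ Y, (y ⬝ᵥ x) ^ 2 ≤ c) → x ⬝ᵥ Q *ᵥ x ≤ c} with hF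
  have hclosed : IsClosed F := by
    have hcont : ∀ x : Fin n → ℝ, Continuous fun Q : Matrix (Fin n) (Fin n) ℝ => x ⬝ᵥ Q *ᵥ x :=
      fun x => by fun_prop
    simp only [hF, posSemidef_iff_dotProduct_mulVec, IsHermitian, star_trivial,
      Set.ofPred_and, Set.ofPred_forall]
    refine ((isClosed_eq (by fun_prop) continuous_id).inter (isClosed_iInter fun x =>
      isClosed_le continuous_const (hcont x))).inter (isClosed_iInter fun x =>
      isClosed_iInter fun c => isClosed_iInter fun _ => isClosed_le (hcont x) continuous_const)
  have hcompact : IsCompact F := by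
    refine (isCompact_univ_pi fun _ : Fin n => isCompact_univ_pi fun _ : Fin n =>
      isCompact_Icc (a := -(2 * K ^ 2)) (b := 2 * K ^ 2)).of_isClosed_subset hclosed ?_
    rintro (Q : Matrix (Fin n) (Fin n) ℝ) ⟨hQ, hQY⟩ i - j -
    have hdiag : ∀ i, Q i i ≤ K ^ 2 := fun i => by
      have := hQY (Pi.single i 1) (K ^ 2) fun y hy => by
        simpa using sq_le_sq' (abs_le.1 (hY y hy i)).1 (abs_le.1 (hY y hy i)).2
      simpa using this
    have := hQ.abs_apply_le i j
    refine abs_le.1 ?_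
    linarith [hdiag i, hdiag j]
  -- The identity is a competitor, so the maximal determinant is at least `1` and the maximizer is
  -- definite.
  have h1 : (1 : Matrix (Fin n) (Fin n) ℝ) ∈ F :=
    ⟨PosSemidef.one, fun x c h => by rw [one_mulVec]; exact hball x c h⟩
  obtain ⟨Q, hQF, hmax⟩ := hcompact.exists_isMaxOn ⟨1, h1⟩
    (f := fun Q : Matrix (Fin n) (Fin n) ℝ => Q.det) (Continuous.continuousOn (by fun_prop))
  have hdet : 0 < Q.det := zero_lt_one.trans_le (by simpa using hmax h1)
  have hQ : Q.PosDef := hQF.1.posDef_iff_det_ne_zero.2 hdet.ne'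
  refine ⟨Q, hQ, fun y hy x => hQ.sq_dotProduct_le (by exact_mod_cast hn) ?_ x, hQF.2⟩
  by_contra! hs
  obtain ⟨m, rfl⟩ : ∃ m, n = m + 1 := ⟨n - 1, by omega⟩
  set s := y ⬝ᵥ Q⁻¹ *ᵥ y with hsdef
  push_cast at hs
  have hm : (0 : ℝ) ≤ m := Nat.cast_nonneg m
  -- By Bernoulli the determinant ratio is at least `1 + t * (s - 1 - m - m * (s - 1) * t)`. This
  -- `t` keeps the bracket positive and `t < 1`, contradicting maximality.
  set t : ℝ := (s - 1 - m) / (2 * (m + 1) * (s - 1)) with ht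
  have hs1 : 0 < s - 1 := by linarith
  have ht0 : 0 < t := by
    rw [ht]
    have : 0 < s - 1 - m := by linarith
    positivity
  have hts : 2 * (m + 1) * (s - 1) * t = s - 1 - m := by
    rw [ht]; field_simp
  have ht1 : t < 1 := by
    rw [ht, div_lt_one (by positivity)]
    nlinarith [mul_nonneg hm hs1.le]
  have hmem : (1 - t) • Q + t • vecMulVec y y ∈ F := by
    refine ⟨(hQF.1.smul (by linarith)).add
      (PosSemidef.smul (by simpa using posSemidef_vecMulVec_self_star y) ht0.le), fun x c h => ?_⟩
    have e1 := hQF.2 x c h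
    have e2 := h y hy
    have e3 : x ⬝ᵥ vecMulVec y y *ᵥ x = (y ⬝ᵥ x) ^ 2 := by
      rw [vecMulVec_mulVec, dotProduct_smul, dotProduct_comm x y]
      simp [sq]
    simp only [add_mulVec, smul_mulVec, dotProduct_add, dotProduct_smul, e3, smul_eq_mul]
    nlinarith
  have hle : ((1 - t) • Q + t • vecMulVec y y).det ≤ Q.det := hmax hmem
  rw [det_convexCombination_vecMulVec hdet.ne'.isUnit y ht1] at hle
  have hle1 : (1 - t) ^ m * (1 + t * (s - 1)) ≤ 1 := by
    by_contra! hlt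
    exact (not_lt.2 hle) (lt_mul_of_one_lt_right hdet hlt)
  have hbern : 1 + (m : ℝ) * (-t) ≤ (1 + -t) ^ m := one_add_mul_le_pow (by linarith) m
  have hpos : 0 < 1 + t * (s - 1) := by positivity
  have hfin := (mul_le_mul_of_nonneg_right hbern hpos.le).trans hle1
  have : t * (s - 1 - m - m * (s - 1) * t) ≤ 0 := by linarith
  have h2 : s - 1 - m ≤ m * (s - 1) * t := by
    by_contra! h
    exact absurd this (not_le.2 (mul_pos ht0 (by linarith)))
  nlinarith [mul_pos hs1 ht0]

end Matrix

/-! ### Quadratic forms and the Euclidean norm -/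

namespace Matrix

variable {n : ℕ}

theorem dotProduct_self_eq_norm_sq (x : Fin n → ℝ) : x ⬝ᵥ x = ‖WithLp.toLp 2 x‖ ^ 2 := by
  rw [EuclideanSpace.real_norm_sq_eq]
  simp [dotProduct, sq]

theorem dotProduct_smul_sub_congruence_mulVec (a : ℝ) (P Q A : Matrix (Fin n) (Fin n) ℝ)
    (x : Fin n → ℝ) : x ⬝ᵥ (a • P - Aᵀ * Q * A) *ᵥ x =
      a * (x ⬝ᵥ P *ᵥ x) - (A *ᵥ x) ⬝ᵥ Q *ᵥ (A *ᵥ x) := by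
  rw [sub_mulVec, dotProduct_sub, smul_mulVec, dotProduct_smul, smul_eq_mul, ← mulVec_mulVec,
    ← mulVec_mulVec, dotProduct_mulVec x Aᵀ, vecMul_transpose]

theorem dotProduct_self_mulVec_le (M : Matrix (Fin n) (Fin n) ℝ) (x : Fin n → ℝ) :
    (M *ᵥ x) ⬝ᵥ (M *ᵥ x) ≤ ‖toEuclideanCLM (n := Fin n) (𝕜 := ℝ) M‖ ^ 2 * (x ⬝ᵥ x) := by
  rw [dotProduct_self_eq_norm_sq, dotProduct_self_eq_norm_sq, ← mul_pow, ← toEuclideanCLM_toLp]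
  exact pow_le_pow_left₀ (norm_nonneg _) (ContinuousLinearMap.le_opNorm _ _) 2

theorem norm_toEuclideanCLM_le {M : Matrix (Fin n) (Fin n) ℝ} {b : ℝ} (hb : 0 ≤ b)
    (h : ∀ x, (M *ᵥ x) ⬝ᵥ (M *ᵥ x) ≤ b ^ 2 * (x ⬝ᵥ x)) :
    ‖toEuclideanCLM (n := Fin n) (𝕜 := ℝ) M‖ ≤ b := by
  refine ContinuousLinearMap.opNorm_le_bound _ hb fun x => ?_
  have := h x.ofLp
  rw [dotProduct_self_eq_norm_sq, dotProduct_self_eq_norm_sq, ← mul_pow,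
    ← toEuclideanCLM_toLp] at this
  exact le_of_sq_le_sq this (by positivity)

theorem dotProduct_mulVec_le (M : Matrix (Fin n) (Fin n) ℝ) (x : Fin n → ℝ) :
    x ⬝ᵥ M *ᵥ x ≤ ‖toEuclideanCLM (n := Fin n) (𝕜 := ℝ) M‖ * (x ⬝ᵥ x) := by
  have h := (real_inner_le_norm (WithLp.toLp 2 x)
    (toEuclideanCLM (n := Fin n) (𝕜 := ℝ) M (WithLp.toLp 2 x))).trans
    (mul_le_mul_of_nonneg_left (ContinuousLinearMap.le_opNorm _ _) (norm_nonneg _))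
  rw [inner_toEuclideanCLM] at h
  rw [dotProduct_self_eq_norm_sq]
  linarith

theorem sq_dotProduct_le_of_le_one {u : Fin n → ℝ} (hu : u ⬝ᵥ u ≤ 1) (x : Fin n → ℝ) :
    (u ⬝ᵥ x) ^ 2 ≤ x ⬝ᵥ x := by
  simpa using PosDef.one.sq_dotProduct_le one_pos (y := u) (by simpa using hu) x

/-- The trace of `Q⁻¹` works: Cauchy–Schwarz with the basis vectors bounds each `x i ^ 2` by `Q⁻¹ i
i` times the form. -/
theorem PosDef.exists_dotProduct_self_le {Q : Matrix (Fin n) (Fin n) ℝ} (hQ : Q.PosDef) :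
    ∃ c : ℝ, 0 ≤ c ∧ ∀ x, x ⬝ᵥ x ≤ c * (x ⬝ᵥ Q *ᵥ x) := by
  have hpos : ∀ i, 0 < Q⁻¹ i i := fun i => hQ.inv.diag_pos
  refine ⟨∑ i, Q⁻¹ i i, Finset.sum_nonneg fun i _ => (hpos i).le, fun x => ?_⟩
  rw [Finset.sum_mul, dotProduct]
  refine Finset.sum_le_sum fun i _ => ?_
  have := hQ.sq_dotProduct_le (y := Pi.single i 1) (hpos i) (by simp [mulVec_single]) x
  simpa [sq] using this

end Matrix

/-! ### Comparison of `cjsr` and `gammaStar` -/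

namespace SwitchingSystem

open Matrix

variable {V E Λ : Type*} {n : ℕ} (S : SwitchingSystem V E Λ n)

local notation "‖" M "‖₂" => ‖Matrix.toEuclideanCLM (n := Fin _) (𝕜 := ℝ) M‖

/-- `p` is a path which, unless empty, starts at `v`. -/
def _root_.Automaton.IsPathFrom (G : Automaton V E Λ) (v : V) (p : List E) : Prop :=
  (∀ e ∈ p.head?, v = G.src e) ∧ G.IsPath p

theorem _root_.Automaton.isPath_cons {G : Automaton V E Λ} {e : E} {p : List E} :
    G.IsPath (e :: p) ↔ G.IsPathFrom (G.tgt e) p :=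
  List.isChain_cons

/-- `γ` and the quadratic forms `Q v` satisfy the constraints that define `gammaStar`. -/
def IsFeasible (γ : ℝ) (Q : V → Matrix (Fin n) (Fin n) ℝ) : Prop :=
  (∀ v, (Q v).PosDef) ∧
    ∀ e : E, (γ ^ 2 • Q (S.graph.src e) - (S.mat (S.graph.label e)).transpose *
      Q (S.graph.tgt e) * S.mat (S.graph.label e)).PosSemidef

variable {S}

theorem IsFeasible.dotProduct_le {γ : ℝ} {Q : V → Matrix (Fin n) (Fin n) ℝ}
    (h : S.IsFeasible γ Q) (e : E) (x : Fin n → ℝ) :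
    (S.mat (S.graph.label e) *ᵥ x) ⬝ᵥ Q (S.graph.tgt e) *ᵥ (S.mat (S.graph.label e) *ᵥ x) ≤
      γ ^ 2 * (x ⬝ᵥ Q (S.graph.src e) *ᵥ x) := by
  have := (h.2 e).dotProduct_mulVec_nonneg x
  rw [star_trivial, dotProduct_smul_sub_congruence_mulVec] at this
  linarith

theorem IsFeasible.dotProduct_self_wordProd_le {γ c : ℝ} {Q : V → Matrix (Fin n) (Fin n) ℝ}
    (h : S.IsFeasible γ Q) (hc0 : 0 ≤ c)
    (hc : ∀ v (x : Fin n → ℝ), x ⬝ᵥ x ≤ c * (x ⬝ᵥ Q v *ᵥ x)) :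
    ∀ (p : List E) (v : V) (x : Fin n → ℝ), S.graph.IsPathFrom v p →
      (S.wordProd (p.map S.graph.label) *ᵥ x) ⬝ᵥ (S.wordProd (p.map S.graph.label) *ᵥ x) ≤
        c * (γ ^ (2 * p.length) * (x ⬝ᵥ Q v *ᵥ x))
  | [], v, x, _ => by simpa [wordProd] using hc v x
  | e :: p, v, x, hp => by
    obtain rfl : v = S.graph.src e := hp.1 e rfl
    rw [List.map_cons, wordProd_cons, ← mulVec_mulVec]
    refine (h.dotProduct_self_wordProd_le hc0 hc p _ _ (Automaton.isPath_cons.1 hp.2)).trans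
      (mul_le_mul_of_nonneg_left ?_ hc0)
    rw [List.length_cons, mul_add, mul_one, pow_add, mul_assoc]
    exact mul_le_mul_of_nonneg_left (h.dotProduct_le e x) ((even_two_mul _).pow_nonneg γ)

theorem IsFeasible.cjsr_le [Finite V] [Finite E] {γ : ℝ} {Q : V → Matrix (Fin n) (Fin n) ℝ}
    (h : S.IsFeasible γ Q) (hγ : 0 ≤ γ) : S.cjsr ≤ γ := by
  cases nonempty_fintype V
  choose c hc0 hc using fun v => (h.1 v).exists_dotProduct_self_le
  set C := ∑ v, c v with hC
  have hC0 : 0 ≤ C := Finset.sum_nonneg fun v _ => hc0 v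
  have hCx : ∀ v (x : Fin n → ℝ), x ⬝ᵥ x ≤ C * (x ⬝ᵥ Q v *ᵥ x) := fun v x =>
    (hc v x).trans (mul_le_mul_of_nonneg_right
      (Finset.single_le_sum (fun v _ => hc0 v) (Finset.mem_univ v))
      (by simpa using (h.1 v).posSemidef.dotProduct_mulVec_nonneg x))
  set D := ∑ v, ‖Q v‖₂ with hD
  have hDx : ∀ v (x : Fin n → ℝ), x ⬝ᵥ Q v *ᵥ x ≤ D * (x ⬝ᵥ x) := fun v x =>
    (dotProduct_mulVec_le _ x).trans (mul_le_mul_of_nonneg_right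
      (Finset.single_le_sum (f := fun v => ‖Q v‖₂) (fun v _ => norm_nonneg _) (Finset.mem_univ v))
      (by rw [dotProduct_self_eq_norm_sq]; positivity))
  -- The `+ 1` makes `B` positive, so that `B ^ (1 / t) → 1`.
  set B := √(C * D) + 1 with hB
  have hB0 : 0 < B := by positivity
  have hBCD : C * D ≤ B ^ 2 := by
    have : C * D ≤ √(C * D) ^ 2 := by
      rw [Real.sq_sqrt (mul_nonneg hC0 (Finset.sum_nonneg fun v _ => norm_nonneg _))]
    nlinarith [Real.sqrt_nonneg (C * D)]
  have hgrowth : ∀ t : ℕ, 1 ≤ t → S.growth t ≤ B ^ ((t : ℝ)⁻¹) * γ := by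
    intro t ht
    refine S.growth_le ht (by positivity) ?_
    rintro _ hw ⟨p, hp, rfl⟩
    rw [List.length_map] at hw
    rw [mul_pow, Real.rpow_inv_natCast_pow hB0.le (by omega)]
    refine norm_toEuclideanCLM_le (by positivity) fun x => ?_
    cases p with
    | nil => simp at hw; omega
    | cons e p =>
      refine (h.dotProduct_self_wordProd_le hC0 hCx (e :: p) (S.graph.src e) x
        ⟨by simp, hp⟩).trans ?_
      have hx : 0 ≤ x ⬝ᵥ x := by rw [dotProduct_self_eq_norm_sq]; positivity
      rw [hw, mul_comm 2 t, pow_mul, mul_pow]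
      calc C * ((γ ^ t) ^ 2 * (x ⬝ᵥ Q (S.graph.src e) *ᵥ x))
          ≤ C * ((γ ^ t) ^ 2 * (D * (x ⬝ᵥ x))) := by gcongr; exact hDx _ x
        _ = (C * D) * ((γ ^ t) ^ 2 * (x ⬝ᵥ x)) := by ring
        _ ≤ B ^ 2 * ((γ ^ t) ^ 2 * (x ⬝ᵥ x)) := by gcongr
        _ = _ := by ring
  have hlim : Tendsto (fun t : ℕ => B ^ ((t : ℝ)⁻¹) * γ) atTop (𝓝 γ) := by
    have := ((Real.continuous_const_rpow hB0.ne').tendsto 0).comp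
      (tendsto_inv_atTop_zero.comp (tendsto_natCast_atTop_atTop (R := ℝ)))
    simpa using this.mul_const γ
  exact le_of_tendsto_of_tendsto S.tendsto_growth hlim
    ((eventually_ge_atTop 1).mono hgrowth)

/-- Long paths satisfy the bound with constant `1` because the growth is eventually below `γ`;
finitely many short paths remain. -/
theorem exists_norm_wordProd_le [Finite E] {γ : ℝ} (hγ : S.cjsr < γ) :
    ∃ K : ℝ, 0 ≤ K ∧ ∀ p : List E, S.graph.IsPath p →
      ‖S.wordProd (p.map S.graph.label)‖₂ ≤ K * γ ^ p.length := by
  have hγ0 : 0 < γ := S.cjsr_nonneg.trans_lt hγ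
  obtain ⟨N, hN⟩ := eventually_atTop.1
    ((S.tendsto_growth.eventually_lt_const hγ).and (eventually_ge_atTop 1))
  obtain ⟨B, hB⟩ := ((List.finite_length_lt E N).image fun p =>
    ‖S.wordProd (p.map S.graph.label)‖₂ / γ ^ p.length).bddAbove
  refine ⟨max B 1, by positivity, fun p hp => ?_⟩
  rcases lt_or_ge p.length N with h | h
  · rw [← div_le_iff₀ (by positivity)]
    exact (hB ⟨p, h, rfl⟩).trans (le_max_left _ _)
  · refine (S.norm_wordProd_le_growth_pow (hN _ h).2 (by simp) ⟨p, hp, rfl⟩).trans ?_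
    refine (pow_le_pow_left₀ (S.growth_nonneg _) (hN _ h).1.le _).trans ?_
    exact le_mul_of_one_le_left (by positivity) (le_max_right _ _)

theorem exists_isFeasible [Finite E] (hn : 1 ≤ n) {γ : ℝ} (hγ : S.cjsr < γ) :
    ∃ Q, S.IsFeasible (√n * γ) Q := by
  have hγ0 : 0 < γ := S.cjsr_nonneg.trans_lt hγ
  obtain ⟨K, hK0, hK⟩ := exists_norm_wordProd_le hγ
  -- These functionals are `γ ^ (-|p|) • A_pᵀ u` with `u` in the unit ball; the supremum of their
  -- absolute values at `x` is the norm `|x|_v`.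
  let Y : V → Set (Fin n → ℝ) := fun v => {y | ∃ (p : List E) (u : Fin n → ℝ),
    S.graph.IsPathFrom v p ∧ u ⬝ᵥ u ≤ 1 ∧
      ∀ x, y ⬝ᵥ x = (γ ^ p.length)⁻¹ * (u ⬝ᵥ S.wordProd (p.map S.graph.label) *ᵥ x)}
  have hY : ∀ v, ∀ y ∈ Y v, ∀ i, |y i| ≤ K := by
    rintro v y ⟨p, u, hp, hu, hy⟩ i
    have h1 := hy (Pi.single i 1)
    rw [dotProduct_single_one] at h1
    refine abs_le_of_sq_le_sq ?_ hK0
    have h2 := (sq_dotProduct_le_of_le_one hu _).trans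
      (dotProduct_self_mulVec_le (S.wordProd (p.map S.graph.label)) (Pi.single i 1))
    rw [dotProduct_single_one, Pi.single_eq_same, mul_one] at h2
    have h3 := h2.trans (pow_le_pow_left₀ (norm_nonneg _) (hK p hp.2) 2)
    rw [h1, mul_pow, inv_pow, inv_mul_le_iff₀ (by positivity)]
    linarith
  have hball : ∀ v, ∀ (x : Fin n → ℝ) (c : ℝ), (∀ y ∈ Y v, (y ⬝ᵥ x) ^ 2 ≤ c) → x ⬝ᵥ x ≤ c := by
    intro v x c h
    have hx : 0 ≤ x ⬝ᵥ x := by rw [dotProduct_self_eq_norm_sq]; positivity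
    have hu : ((√(x ⬝ᵥ x))⁻¹ • x) ⬝ᵥ x = √(x ⬝ᵥ x) := by
      rw [smul_dotProduct, smul_eq_mul, inv_mul_eq_div, Real.div_sqrt]
    -- The empty path with `u = x / ‖x‖` gives `‖x‖ ≤ |x|_v`; for `x = 0` the convention `0⁻¹ = 0`
    -- gives `u = 0`.
    have := h ((√(x ⬝ᵥ x))⁻¹ • x) ⟨[], (√(x ⬝ᵥ x))⁻¹ • x, ⟨by simp, List.isChain_nil⟩, by
      rw [dotProduct_smul, hu, smul_eq_mul]; exact inv_mul_le_one, fun z => by simp [wordProd]⟩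
    rwa [hu, Real.sq_sqrt hx] at this
  choose Q hQ hQ1 hQ2 using fun v => exists_posDef_john hn (hY v) (hball v)
  refine ⟨Q, hQ, fun e => PosSemidef.of_dotProduct_mulVec_nonneg ?_ fun x => ?_⟩
  · refine ((hQ _).1.smul (by simp [IsSelfAdjoint])).sub ?_
    simpa using isHermitian_conjTranspose_mul_mul (S.mat (S.graph.label e))
      (hQ (S.graph.tgt e)).1
  · rw [star_trivial, dotProduct_smul_sub_congruence_mulVec, sub_nonneg]
    refine hQ2 _ _ _ ?_
    rintro y ⟨p, u, hp, hu, hy⟩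
    -- Prepending `e` to `p` costs one factor `γ⁻¹`; this is the contraction `|A x|_w ≤ γ * |x|_v`
    -- in dual form.
    have hmem : γ⁻¹ • ((S.mat (S.graph.label e))ᵀ *ᵥ y) ∈ Y (S.graph.src e) := by
      refine ⟨e :: p, u, ⟨by simp, Automaton.isPath_cons.2 hp⟩, hu, fun z => ?_⟩
      rw [smul_dotProduct, mulVec_transpose, ← dotProduct_mulVec, hy, List.map_cons,
        wordProd_cons, mulVec_mulVec, List.length_cons, pow_succ, mul_inv, smul_eq_mul]
      ring
    have := hQ1 _ _ hmem x
    rw [smul_dotProduct, mulVec_transpose, ← dotProduct_mulVec, smul_eq_mul, mul_pow, inv_pow,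
      inv_mul_le_iff₀ (by positivity)] at this
    rw [mul_pow, Real.sq_sqrt (Nat.cast_nonneg n)]
    linarith

theorem gammaStar_nonneg : 0 ≤ S.gammaStar :=
  Real.sInf_nonneg fun _ h => h.1

theorem gammaStar_le [Finite E] (hn : 1 ≤ n) : S.gammaStar ≤ √n * S.cjsr := by
  have hn0 : 0 < √(n : ℝ) := Real.sqrt_pos.2 (by exact_mod_cast hn)
  rw [← div_le_iff₀' hn0]
  -- Feasibility is available only for `γ` strictly above `cjsr`, where the norms `|·|_v` are
  -- finite, so the bound is obtained as `γ` decreases to `cjsr`.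
  refine le_of_forall_gt_imp_ge_of_dense fun γ hγ => ?_
  rw [div_le_iff₀' hn0]
  exact csInf_le ⟨0, fun _ h => h.1⟩
    ⟨mul_nonneg hn0.le (S.cjsr_nonneg.trans hγ.le), exists_isFeasible hn hγ⟩

theorem cjsr_le_gammaStar [Finite V] [Finite E] (hn : 1 ≤ n) : S.cjsr ≤ S.gammaStar := by
  refine le_csInf ?_ fun γ h => IsFeasible.cjsr_le h.2.choose_spec h.1
  -- Nonemptiness is essential: the infimum of the empty set would be `0`.
  exact ⟨√n * (S.cjsr + 1), mul_nonneg (Real.sqrt_nonneg _) (by linarith [S.cjsr_nonneg]),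
    exists_isFeasible hn (lt_add_one _)⟩

variable (S)

theorem cjsr_le_prodLift_gammaStar_rpow [Finite V] [Finite E] (hn : 1 ≤ n) {T : ℕ} (hT : 1 ≤ T) :
    S.cjsr ≤ (S.prodLift T hT).gammaStar ^ (1 / (T : ℝ)) := by
  have h : S.cjsr ^ T ≤ (S.prodLift T hT).gammaStar :=
    (S.prodLift_cjsr hT).symm.trans_le (cjsr_le_gammaStar hn)
  have := Real.rpow_le_rpow (pow_nonneg S.cjsr_nonneg T) h (inv_nonneg.2 (Nat.cast_nonneg T))
  rwa [Real.pow_rpow_inv_natCast S.cjsr_nonneg (by omega), ← one_div] at this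

theorem prodLift_gammaStar_rpow_le [Finite E] (hn : 1 ≤ n) {T : ℕ} (hT : 1 ≤ T) :
    (S.prodLift T hT).gammaStar ^ (1 / (T : ℝ)) ≤ (n : ℝ) ^ (1 / (2 * (T : ℝ))) * S.cjsr := by
  have h : (S.prodLift T hT).gammaStar ≤ √n * S.cjsr ^ T :=
    S.prodLift_cjsr hT ▸ gammaStar_le hn
  rw [one_div]
  refine (Real.rpow_le_rpow gammaStar_nonneg h (inv_nonneg.2 (Nat.cast_nonneg T))).trans_eq ?_
  rw [Real.mul_rpow (Real.sqrt_nonneg _) (pow_nonneg S.cjsr_nonneg T),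
    Real.pow_rpow_inv_natCast S.cjsr_nonneg (by omega), Real.sqrt_eq_rpow,
    ← Real.rpow_mul (Nat.cast_nonneg n)]
  congr 2
  rw [one_div, one_div, mul_inv]

end SwitchingSystem

/-! ### The choice of `T` and the conclusion -/

theorem rpow_le_one_add_of_log_div_le {n : ℕ} (hn : 1 ≤ n) {r : ℝ} (hr : 0 < r) {T : ℕ}
    (hT : 1 ≤ T) (h : Real.log n / (2 * Real.log (1 + r)) ≤ T) :
    (n : ℝ) ^ (1 / (2 * (T : ℝ))) ≤ 1 + r := by
  have hn0 : (0 : ℝ) < n := by exact_mod_cast hn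
  have hT0 : (0 : ℝ) < T := by exact_mod_cast hT
  have hlog : 0 < Real.log (1 + r) := Real.log_pos (by linarith)
  rw [← Real.log_le_log_iff (by positivity) (by positivity), Real.log_rpow hn0, one_div,
    inv_mul_le_iff₀ (by positivity)]
  rw [div_le_iff₀ (by positivity)] at h
  linarith

theorem mainTheorem4 {V E Λ : Type*} [Finite V] [Finite E] [Finite Λ] [Nonempty E]
    {n : ℕ} (hn : 1 ≤ n) (S : SwitchingSystem V E Λ n) (hS : S.graph.StronglyConnected) :
    -- the limit that defines the constrained joint spectral radius of `S` exists
    Tendsto S.growth atTop (𝓝 S.cjsr) ∧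
    -- the theorem
    (∀ (T : ℕ) (hT : 1 ≤ T),
      Tendsto (S.prodLift T hT).growth atTop (𝓝 (S.prodLift T hT).cjsr) ∧
      (S.prodLift T hT).cjsr = S.cjsr ^ T ∧
      S.cjsr ≤ (S.prodLift T hT).gammaStar ^ (1 / (T : ℝ)) ∧
      (S.prodLift T hT).gammaStar ^ (1 / (T : ℝ)) ≤ (n : ℝ) ^ (1 / (2 * (T : ℝ))) * S.cjsr) ∧
    -- the corollary
    (∀ r : ℝ, 0 < r → ∀ (T : ℕ) (hT : 1 ≤ T),
      T = max 1 ⌈Real.log n / (2 * Real.log (1 + r))⌉₊ →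
      S.cjsr ≤ (S.prodLift T hT).gammaStar ^ (1 / (T : ℝ)) ∧
      (S.prodLift T hT).gammaStar ^ (1 / (T : ℝ)) ≤ (1 + r) * S.cjsr) := by
  have hbounds := fun (T : ℕ) (hT : 1 ≤ T) =>
    And.intro (S.cjsr_le_prodLift_gammaStar_rpow hn hT) (S.prodLift_gammaStar_rpow_le hn hT)
  refine ⟨S.tendsto_growth, fun T hT => ⟨(S.prodLift T hT).tendsto_growth, S.prodLift_cjsr hT,
    hbounds T hT⟩, fun r hr T hT h => ⟨(hbounds T hT).1, (hbounds T hT).2.trans ?_⟩⟩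
  refine mul_le_mul_of_nonneg_right (rpow_le_one_add_of_log_div_le hn hr hT ?_) S.cjsr_nonneg
  rw [h]
  exact (Nat.le_ceil _).trans (Nat.cast_le.2 (le_max_right _ _))
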